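/- Let $S^1=\{z\in\mathbb C:|z|=1\}$ and let $dz$ be normalized Lebesgue measure on $S^1$. Let $P_1,P_2,\dots$ be complex polynomials such that (i) $\int_{S^1}|P_{i_1}P_{i_2}\cdots P_{i_k}|^2\,dz=1$ for all $i_1<\dots<i_k$, $k\ge 1$; (ii) for every infinite sequence $i_1<i_2<\cdots$ the measures $|P_{i_1}\cdots P_{i_k}|^2\,dz$ converge weakly as $k\to\infty$; the limit is denoted $\prod_{j=1}^\infty|P_{i_j}|^2$. Let $\mu=\prod_{j=1}^\infty|P_j|^2$ be the resulting generalized Riesz product, and write $\frac{d\mu}{dz}$ for the density of the part of $\mu$ that is absolutely continuous with respect to $dz$. Assume that $\mu$ is of class (L): for every sequence $k_1<k_2<\cdots$ of positive integers the tail measures $\prod_{j=n+1}^\infty|P_{k_j}|^2$ converge weakly to $dz$ as $n\to\infty$. Assume also that every $P_j$ is outer, i.e. has no zero in the open unit disc. Put $S_n=\prod_{j=1}^nP_j$ and $\phi_n=S_n/|S_n|$ (defined $dz$-a.e. on $S^1$). Suppose that some $\phi\in L^\infty(S^1,dz)$ is the weak* limit of a subsequence of $(\phi_n)$, where $L^\infty(S^1,dz)$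 is regarded as the dual of $L^1(S^1,dz)$, and that $\phi\neq0$ $dz$-a.e. on the set $\{z:\frac{d\mu}{dz}(z)>0\}$. Then either $\mu$ is singular to Lebesgue measure, or its absolutely continuous part has positive Mahler measure $$\exp\Bigl(\int_{S^1}\log\frac{d\mu}{dz}\,dz\Bigr)>0\qquad(\log 0=-\infty);$$ that is, in the second case, $\frac{d\mu}{dz}>0$ $dz$-a.e. and $\log\frac{d\mu}{dz}\in L^1(S^1,dz)$. -/

import Mathlib

open MeasureTheory Filter Topology Polynomial
open scoped ENNReal

noncomputable section

namespace RieszProduct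

/-- The circle group `S¹`, parametrized by `ℝ/ℤ` through `t ↦ e^{2πit}`. -/
abbrev S1 : Type := UnitAddCircle

/-- Normalized Lebesgue (Haar) measure `dz` on the circle. -/
def leb : Measure S1 := AddCircle.haarAddCircle

instance leb.instIsProbabilityMeasure : IsProbabilityMeasure leb :=
  inferInstanceAs (IsProbabilityMeasure AddCircle.haarAddCircle)

/-- Lebesgue measure as an element of the space of finite measures (with its weak topology). -/
def lebFinite : FiniteMeasure S1 := ⟨leb, inferInstance⟩

/-- The value of the polynomial `Q` at the point `z = e^{2πit}` of the circle. -/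
def onCircle (Q : ℂ[X]) (t : S1) : ℂ := Q.eval (AddCircle.toCircle t : ℂ)

theorem continuous_onCircle (Q : ℂ[X]) : Continuous (onCircle Q) :=
  Q.continuous.comp (continuous_subtype_val.comp AddCircle.continuous_toCircle)

theorem lintegral_onCircle_lt_top (Q : ℂ[X]) :
    ∫⁻ t, ‖onCircle Q t‖ₑ ^ 2 ∂leb < ∞ := by
  have hc : IsCompact (Set.range fun t => ‖onCircle Q t‖ₑ ^ 2) :=
    isCompact_range
      ((ENNReal.continuous_pow 2).comp (continuous_enorm.comp (continuous_onCircle Q)))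
  obtain ⟨_, ⟨t₀, rfl⟩, hx⟩ := hc.exists_isGreatest (Set.range_nonempty _)
  calc ∫⁻ t, ‖onCircle Q t‖ₑ ^ 2 ∂leb ≤ ∫⁻ _, ‖onCircle Q t₀‖ₑ ^ 2 ∂leb :=
        lintegral_mono fun t => hx ⟨t, rfl⟩
    _ < ∞ := by simp

/-- The measure `|Q(z)|² dz`. -/
def sqMeasure (Q : ℂ[X]) : FiniteMeasure S1 :=
  ⟨leb.withDensity fun t => ‖onCircle Q t‖ₑ ^ 2,
    isFiniteMeasure_withDensity (lintegral_onCircle_lt_top Q).ne⟩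

/-- The partial product `S_n = P_1 ⋯ P_n` (the sequence is indexed from `0`: `P j` is `P_{j+1}`). -/
def partialProd (P : ℕ → ℂ[X]) (n : ℕ) : ℂ[X] := ∏ j ∈ Finset.range n, P j

/-- `μ` is the generalized Riesz product `∏ |P_j|²`: every finite subproduct has `L²`-norm one, the
measures attached to every infinite subproduct converge weakly, and `μ` is the weak limit of
`|P_1 ⋯ P_n|² dz`. -/
structure IsGeneralizedRieszProduct (P : ℕ → ℂ[X]) (μ : FiniteMeasure S1) : Prop where
  norm_eq_one : ∀ s : Finset ℕ, s.Nonempty →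
    ∫ t, ‖onCircle (∏ j ∈ s, P j) t‖ ^ 2 ∂leb = 1
  exists_limit : ∀ k : ℕ → ℕ, StrictMono k → ∃ ν : FiniteMeasure S1,
    Tendsto (fun n => sqMeasure (partialProd (fun i => P (k i)) n)) atTop (𝓝 ν)
  tendsto : Tendsto (fun n => sqMeasure (partialProd P n)) atTop (𝓝 μ)

/-- Class (L): for every `k_1 < k_2 < ⋯` the tails `∏_{j > n} |P_{k_j}|²` of the subproduct
converge weakly to Lebesgue measure as `n → ∞`. -/
def IsClassL (P : ℕ → ℂ[X]) : Prop :=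
  ∀ k : ℕ → ℕ, StrictMono k → ∃ ν : ℕ → FiniteMeasure S1,
    (∀ n, IsGeneralizedRieszProduct (fun i => P (k (n + i))) (ν n)) ∧
      Tendsto ν atTop (𝓝 lebFinite)

/-- A polynomial is outer when it has no zero in the open unit disc (i.e. its Beurling inner
factor is constant). -/
def IsOuter (Q : ℂ[X]) : Prop := ∀ w : ℂ, ‖w‖ < 1 → Q.eval w ≠ 0

/-- The phase `φ_n = S_n / |S_n|` (defined off the finitely many zeros of `S_n`). -/
def phase (P : ℕ → ℂ[X]) (n : ℕ) (t : S1) : ℂ :=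
  onCircle (partialProd P n) t / (‖onCircle (partialProd P n) t‖ : ℂ)

/-- Weak* convergence `ψ_n → φ` in `L^∞(S¹, dz) = L¹(S¹, dz)^*`. -/
def WeakStarTendsto (ψ : ℕ → S1 → ℂ) (φ : S1 → ℂ) : Prop :=
  ∀ g : S1 → ℂ, Integrable g leb →
    Tendsto (fun n => ∫ t, g t * ψ n t ∂leb) atTop (𝓝 (∫ t, g t * φ t ∂leb))

/-- `φ ∈ L^∞(S¹, dz)` is a weak* limit of the sequence `ψ`, along some subsequence. -/
def IsWeakStarLimit (ψ : ℕ → S1 → ℂ) (φ : S1 → ℂ) : Prop :=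
  MemLp φ ∞ leb ∧ ∃ n : ℕ → ℕ, StrictMono n ∧ WeakStarTendsto (fun i => ψ (n i)) φ

/-- `dμ/dz`, the density of the absolutely continuous part of `μ`. -/
def density (μ : Measure S1) : S1 → ℝ≥0∞ := μ.rnDeriv leb

/-- The absolutely continuous part of `μ` with respect to `dz`. -/
def acPart (μ : Measure S1) : Measure S1 := leb.withDensity (density μ)

/-- `∫ log (dμ/dz) dz` in `[-∞, ∞]`, where `log 0 = -∞`: the integral of the positive part minus
that of the negative part (the former is finite for a finite measure, as `log⁺ x ≤ x`). -/
def logIntegral (μ : Measure S1) : EReal :=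
  ((∫⁻ t, (ENNReal.log (density μ t)).toENNReal ∂leb : ℝ≥0∞) : EReal) -
    ((∫⁻ t, (-ENNReal.log (density μ t)).toENNReal ∂leb : ℝ≥0∞) : EReal)

/-- The Mahler measure `M(μ) = exp (∫ log (dμ/dz) dz)`. -/
def mahlerMeasure (μ : Measure S1) : ℝ≥0∞ := EReal.exp (logIntegral μ)

end RieszProduct

end

namespace RieszProduct

/-! Write b = √(dμ/dz), let ν_n be the tail measures and c_n = √(dν_n/dz). The point is that bφ is a
nonzero function of H², so its logarithm has integral > -∞; since φ is bounded, the same holds for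
log b.

Convergence |S_n| → b in L¹ (`tendsto_integral_abs_norm_sub_sqrtDensity`): from μ = |S_n|² ν_n one
gets b = |S_n| c_n, hence ∫|S_n|(1 - c_n)² = ∫|S_n| + ∫ b c_n - 2∫b. The affinity with Lebesgue
measure is upper semicontinuous under weak convergence, so limsup ∫|S_n| ≤ ∫b; class (L), i.e. ν_n →
dz, gives limsup ∫ b c_n ≤ ∫b. The left side thus tends to 0, and a Cauchy–Schwarz argument yields
∫|S_n||1 - c_n| = ∫||S_n| - b| → 0.

Analyticity (`fourierCoeff_neg_eq_zero_of_isWeakStarLimit`): S_n = φ_n|S_n| has no negative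
frequencies, and strong convergence of |S_n| together with weak* convergence of φ_n passes this on
to bφ. If μ is not singular, b > 0 on a set of positive measure, where φ ≠ 0, so bφ is not zero.

Logarithms: Jensen's inequality is applied to polynomial truncations of z^{-m} bφ, where m is the
first nonzero frequency. With log(· + ε) in place of log it survives L² limits, and the resulting
bound does not depend on ε. -/

/-! ### Jensen's inequality and log-integrals in H² -/

theorem integral_leb_eq_circleAverage (f : ℂ → ℝ) :
    ∫ t, f (AddCircle.toCircle t : ℂ) ∂leb = Real.circleAverage f 0 1 := by
  have h1 : ∫ t, f (AddCircle.toCircle t : ℂ) ∂leb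
      = ∫ t : UnitAddCircle, f (AddCircle.toCircle t : ℂ) := by
    rw [leb, AddCircle.integral_haarAddCircle]; simp
  rw [h1, ← UnitAddCircle.intervalIntegral_preimage 0, Real.circleAverage_def]
  have h2 := intervalIntegral.smul_integral_comp_mul_left
    (fun θ => f (circleMap 0 1 θ)) (2 * Real.pi) (a := 0) (b := 0 + 1)
  rw [mul_zero, zero_add, mul_one] at h2
  rw [← h2, smul_smul, inv_mul_cancel₀ (by positivity), one_smul, zero_add]
  refine intervalIntegral.integral_congr fun t _ => ?_
  simp [AddCircle.toCircle_apply_mk, circleMap, Circle.coe_exp]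

theorem log_norm_eval_zero_le_integral (p : ℂ[X]) (hp : p.eval 0 ≠ 0) {ε : ℝ} (hε : 0 < ε) :
    Real.log ‖p.eval 0‖ ≤ ∫ t, Real.log (‖onCircle p t‖ + ε) ∂leb := by
  have hp0 : p ≠ 0 := by rintro rfl; simp at hp
  have h1 : Real.log ‖p.eval 0‖ ≤ p.logMahlerMeasure := by
    rw [logMahlerMeasure_eq_log_MahlerMeasure]
    refine Real.log_le_log (norm_pos_iff.2 hp) ?_
    -- Jensen's inequality is the case of the constant coefficient, whose binomial factor is 1.
    have := norm_coeff_le_choose_mul_mahlerMeasure 0 p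
    simpa [coeff_zero_eq_eval_zero] using this
  refine h1.trans ?_
  have h2 := integral_leb_eq_circleAverage fun z => Real.log (‖p.eval z‖ + ε)
  unfold onCircle
  rw [h2, logMahlerMeasure_def, Real.circleAverage_def, Real.circleAverage_def]
  refine smul_le_smul_of_nonneg_left ?_ (by positivity)
  have hcont : Continuous fun θ : ℝ => Real.log (‖p.eval (circleMap 0 1 θ)‖ + ε) :=
    ((p.continuous.comp (continuous_circleMap 0 1)).norm.add continuous_const).log
      fun θ => (add_pos_of_nonneg_of_pos (norm_nonneg _) hε).ne'
  refine intervalIntegral.integral_mono_ae Real.two_pi_pos.le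
    (p.intervalIntegrable_mahlerMeasure) (hcont.intervalIntegrable _ _) ?_
  -- At zeros of p on the circle the convention log 0 = 0 would break the comparison when ε < 1;
  -- they form a countable set.
  have hz : ((circleMap 0 1) ⁻¹' {z : ℂ | p.IsRoot z}).Countable :=
    Set.Countable.preimage_circleMap (Polynomial.finite_setOfPred_isRoot hp0).countable 0 one_ne_zero
  filter_upwards [measure_eq_zero_iff_ae_notMem.1 (hz.measure_zero volume)] with θ hθ
  have : 0 < ‖p.eval (circleMap 0 1 θ)‖ := norm_pos_iff.2 hθ
  exact Real.log_le_log this (by linarith)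

theorem integrable_log_add {g : S1 → ℝ} (hg : Integrable g leb) (h0 : ∀ t, 0 ≤ g t)
    {ε : ℝ} (hε : 0 < ε) : Integrable (fun t => Real.log (g t + ε)) leb := by
  refine Integrable.mono' (hg.add (integrable_const (ε + |Real.log ε|)))
    (Real.measurable_log.comp_aemeasurable
      (hg.aemeasurable.add_const ε)).aestronglyMeasurable (.of_forall fun t => ?_)
  have h1 : Real.log ε ≤ Real.log (g t + ε) := Real.log_le_log hε (by linarith [h0 t])
  have h2 := Real.log_le_sub_one_of_pos (show 0 < g t + ε by linarith [h0 t])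
  have h3 := neg_abs_le (Real.log ε)
  have h4 := abs_nonneg (Real.log ε)
  simp only [Real.norm_eq_abs, Pi.add_apply]
  rw [abs_le]
  constructor <;> linarith [h0 t]

/-- The logarithm is 1/ε-Lipschitz on [ε, ∞); this is what makes the regularized log-integral
continuous in L¹. -/
theorem log_add_sub_log_add_le {x y ε : ℝ} (hx : 0 ≤ x) (hy : 0 ≤ y) (hε : 0 < ε) :
    Real.log (x + ε) - Real.log (y + ε) ≤ |x - y| / ε := by
  rw [← Real.log_div (by positivity) (by positivity)]
  refine (Real.log_le_sub_one_of_pos (by positivity)).trans ?_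
  rw [div_sub_one (by positivity)]
  calc (x + ε - (y + ε)) / (y + ε) ≤ |x - y| / (y + ε) := by
        gcongr; rw [add_sub_add_right_eq_sub]; exact le_abs_self _
    _ ≤ |x - y| / ε := by gcongr; linarith

theorem fourier_natCast_apply (n : ℕ) (t : S1) :
    (fourier (n : ℤ) t : ℂ) = (AddCircle.toCircle t : ℂ) ^ n := by
  simp [fourier_apply, AddCircle.toCircle_nsmul]

/-- A nonzero function of the Hardy space `H²` has a log-integral bounded below. -/
theorem exists_le_integral_log_of_fourierCoeff_neg_eq_zero {F : S1 → ℂ} (hF : MemLp F 2 leb)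
    (hneg : ∀ n : ℤ, n < 0 → fourierCoeff F n = 0) (hne : ¬ F =ᵐ[leb] 0) :
    ∃ C : ℝ, ∀ ε : ℝ, 0 < ε → C ≤ ∫ t, Real.log (‖F t‖ + ε) ∂leb := by
  set G : Lp ℂ 2 (AddCircle.haarAddCircle (T := 1)) := hF.toLp F with hG
  have hGF : (G : S1 → ℂ) =ᵐ[leb] F := hF.coeFn_toLp
  have hcoef : ∀ n, fourierCoeff (G : S1 → ℂ) n = fourierCoeff F n := fun n =>
    congrFun (fourierCoeff_congr_ae hGF) n
  have hsum := hasSum_fourier_series_L2 G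
  simp only [hcoef] at hsum
  have hex : ∃ n : ℕ, fourierCoeff F n ≠ 0 := by
    by_contra! h
    have h0 : ∀ n : ℤ, fourierCoeff F n = 0 := fun n => by
      rcases lt_or_ge n 0 with hn | hn
      · exact hneg n hn
      · lift n to ℕ using hn; exact h n
    simp only [h0, zero_smul] at hsum
    have hG0 : G = 0 := hsum.unique hasSum_zero
    refine hne (hGF.symm.trans ?_)
    rw [hG0]
    exact Lp.coeFn_zero ..
  classical
  set m := Nat.find hex with hm
  have hm0 : fourierCoeff F m ≠ 0 := Nat.find_spec hex
  have hmlt : ∀ n : ℤ, n < m → fourierCoeff F n = 0 := fun n hn => by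
    rcases lt_or_ge n 0 with h | h
    · exact hneg n h
    · lift n to ℕ using h
      simpa using Nat.find_min hex (by exact_mod_cast hn)
  have hinj : Function.Injective fun j : ℕ => (m : ℤ) + j := fun i j h => by
    simpa using h
  rw [← hinj.hasSum_iff] at hsum
  swap
  · intro n hn
    rw [hmlt n, zero_smul]
    by_contra! h
    exact hn ⟨(n - m).toNat, by simp only [Int.toNat_sub_of_le h]; ring⟩
  have hlim := hsum.tendsto_sum_nat
  refine ⟨Real.log ‖fourierCoeff F m‖, fun ε hε => ?_⟩
  -- Truncations of z^{-m}F: dividing by z^m leaves moduli on the circle unchanged and makes the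
  -- value at 0 the nonzero coefficient of index m.
  set p : ℕ → ℂ[X] := fun N => ∑ j ∈ Finset.range N, C (fourierCoeff F (m + j)) * X ^ j with hp
  have hp0 : ∀ N, (p (N + 1)).eval 0 = fourierCoeff F m := fun N => by
    simp [hp, eval_finsetSum, Finset.sum_range_succ']
  set H : ℕ → Lp ℂ 2 (AddCircle.haarAddCircle (T := 1)) := fun N => ∑ j ∈ Finset.range N,
    fourierCoeff F (m + j) • fourierLp 2 ((m : ℤ) + j) with hH
  have hHp : ∀ N, (H N : S1 → ℂ) =ᵐ[leb] fun t => fourier m t * onCircle (p N) t := fun N => by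
    have h1 : ∀ᵐ t ∂leb, ∀ j : ℕ, (fourierLp 2 ((m : ℤ) + j) : Lp ℂ 2 _) t
        = fourier ((m : ℤ) + j) t := ae_all_iff.2 fun j => coeFn_fourierLp 2 _
    have h2 : ∀ᵐ t ∂leb, ∀ j : ℕ, (fourierCoeff F (m + j) •
        (fourierLp 2 ((m : ℤ) + j) : Lp ℂ 2 (AddCircle.haarAddCircle (T := 1))) : Lp ℂ 2 _) t
        = fourierCoeff F (m + j) • (fourierLp 2 ((m : ℤ) + j) : Lp ℂ 2 _) t :=
      ae_all_iff.2 fun j => Lp.coeFn_smul _ _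
    filter_upwards [h1, h2, (Lp.coeFn_finsetSum (Finset.range N) fun j : ℕ =>
      fourierCoeff F (m + j) • (fourierLp 2 ((m : ℤ) + j) : Lp ℂ 2
        (AddCircle.haarAddCircle (T := 1))))] with t h1 h2 h3
    rw [hH, h3]
    simp only [Finset.sum_apply, h2, h1, onCircle, hp, eval_finsetSum, Finset.mul_sum]
    refine Finset.sum_congr rfl fun j _ => ?_
    simp only [fourier_add, eval_mul, eval_C, eval_pow, eval_X, smul_eq_mul]
    rw [fourier_natCast_apply j]; ring
  have hbound : ∀ N, Real.log ‖fourierCoeff F m‖ - ‖H (N + 1) - G‖ / ε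
      ≤ ∫ t, Real.log (‖F t‖ + ε) ∂leb := fun N => by
    have hFi : Integrable F leb := hF.integrable (by norm_num)
    have hpc := continuous_onCircle (p (N + 1))
    have hpi : Integrable (onCircle (p (N + 1))) leb :=
      hpc.integrable_of_hasCompactSupport (HasCompactSupport.of_compactSpace _)
    have hJ := log_norm_eval_zero_le_integral (p (N + 1)) (by rwa [hp0]) hε
    rw [hp0] at hJ
    have hD : Integrable (fun t => ‖(H (N + 1) - G : Lp ℂ 2 _) t‖) leb :=
      ((Lp.memLp (H (N + 1) - G)).integrable (by norm_num)).norm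
    have hL2 : ∫ t, ‖(H (N + 1) - G : Lp ℂ 2 _) t‖ ∂leb ≤ ‖H (N + 1) - G‖ := by
      have h1 := eLpNorm_le_eLpNorm_of_exponent_le (μ := leb) (p := 1) (q := 2) (by norm_num)
        (Lp.aestronglyMeasurable (H (N + 1) - G))
      rw [integral_norm_eq_lintegral_enorm (μ := leb) (Lp.aestronglyMeasurable (H (N + 1) - G)),
        ← eLpNorm_one_eq_lintegral_enorm, Lp.norm_def]
      exact ENNReal.toReal_mono (Lp.memLp _).eLpNorm_ne_top h1
    have h3 : ∫ t, (Real.log (‖onCircle (p (N + 1)) t‖ + ε) - Real.log (‖F t‖ + ε)) ∂leb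
        ≤ ∫ t, ‖(H (N + 1) - G : Lp ℂ 2 _) t‖ / ε ∂leb := by
      refine integral_mono_ae ((integrable_log_add hpi.norm (fun _ => norm_nonneg _) hε).sub
        (integrable_log_add hFi.norm (fun _ => norm_nonneg _) hε)) (hD.div_const ε) ?_
      filter_upwards [hHp (N + 1), hGF, Lp.coeFn_sub (H (N + 1)) G] with t h1 h2 h3
      refine (log_add_sub_log_add_le (norm_nonneg _) (norm_nonneg _) hε).trans ?_
      gcongr
      rw [h3, Pi.sub_apply, h1, h2]
      have : ‖onCircle (p (N + 1)) t‖ = ‖fourier m t * onCircle (p (N + 1)) t‖ := by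
        rw [norm_mul, fourier_apply, Circle.norm_coe, one_mul]
      rw [this]
      exact abs_norm_sub_norm_le _ _
    rw [integral_sub (integrable_log_add hpi.norm (fun _ => norm_nonneg _) hε)
        (integrable_log_add hFi.norm (fun _ => norm_nonneg _) hε), integral_div] at h3
    have h4 : (∫ t, ‖(H (N + 1) - G : Lp ℂ 2 _) t‖ ∂leb) / ε ≤ ‖H (N + 1) - G‖ / ε := by
      gcongr
    linarith
  have hlim' : Tendsto (fun N => Real.log ‖fourierCoeff F m‖ - ‖H (N + 1) - G‖ / ε) atTop
      (𝓝 (Real.log ‖fourierCoeff F m‖ - 0 / ε)) := by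
    refine tendsto_const_nhds.sub (Tendsto.div_const ?_ ε)
    have h1 : Tendsto H atTop (𝓝 G) := hlim
    exact (tendsto_iff_norm_sub_tendsto_zero.1 h1).comp (tendsto_add_atTop_nat 1)
  rw [zero_div, sub_zero] at hlim'
  exact le_of_tendsto' hlim' hbound

/-! ### Removing the regularization -/

/-- Passing to the limit `ε → 0` in lower bounds for `∫ log (b + ε)`. -/
theorem pos_and_integrable_log_of_le_integral {b : S1 → ℝ} (hb : Integrable b leb)
    (h0 : ∀ t, 0 ≤ b t) {C : ℝ}
    (hC : ∀ ε : ℝ, 0 < ε → C ≤ ∫ t, Real.log (b t + ε) ∂leb) :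
    (∀ᵐ t ∂leb, 0 < b t) ∧ Integrable (fun t => Real.log (b t)) leb := by
  have hs : NullMeasurableSet {t | b t = 0} leb :=
    nullMeasurableSet_eq_fun hb.aemeasurable aemeasurable_const
  have hpos : ∀ᵐ t ∂leb, 0 < b t := by
    -- Off the zero set, log(b + ε) ≤ b + ε - 1 ≤ b; on it the integrand is log ε, so positive
    -- measure would drive the bound to -∞.
    have key : ∀ ε : ℝ, 0 < ε → ε < 1 →
        C ≤ (∫ t, b t ∂leb) + leb.real {t | b t = 0} * Real.log ε := by
      intro ε hε hε1
      refine (hC ε hε).trans ?_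
      have hind : Integrable ({t | b t = 0}.indicator fun _ => Real.log ε) leb :=
        (integrable_const _).indicator₀ hs
      have : ∫ t, {t | b t = 0}.indicator (fun _ => Real.log ε) t ∂leb
          = leb.real {t | b t = 0} * Real.log ε := by
        rw [integral_indicator₀ hs]; simp
      rw [← this, ← integral_add hb hind]
      refine integral_mono (integrable_log_add hb h0 hε) (hb.add hind) fun t => ?_
      by_cases ht : b t = 0
      · simp [ht]
      · have := Real.log_le_sub_one_of_pos (show 0 < b t + ε by linarith [h0 t])
        simp only [Set.mem_ofPred_eq, ht, not_false_eq_true, Set.indicator_of_notMem]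
        linarith
    have hz : leb.real {t | b t = 0} = 0 := by
      by_contra hne
      have hpos : 0 < leb.real {t | b t = 0} := lt_of_le_of_ne measureReal_nonneg (Ne.symm hne)
      have hbot : Tendsto (fun ε => (∫ t, b t ∂leb) + leb.real {t | b t = 0} * Real.log ε)
          (𝓝[>] 0) atBot :=
        tendsto_atBot_add_const_left _ _ (Real.tendsto_log_nhdsGT_zero.const_mul_atBot hpos)
      obtain ⟨ε, hε1, hε2, hε3⟩ := ((hbot.eventually_lt_atBot C).and
        (Ioo_mem_nhdsGT (show (0 : ℝ) < 1 by norm_num))).exists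
      exact absurd (key ε hε2 hε3) (not_le.2 hε1)
    rw [measureReal_eq_zero_iff] at hz
    filter_upwards [measure_eq_zero_iff_ae_notMem.1 hz] with t ht
    exact lt_of_le_of_ne (h0 t) (Ne.symm ht)
  refine ⟨hpos, ?_⟩
  set e : ℕ → ℝ := fun n => 1 / ((n : ℝ) + 1) with he
  have hepos : ∀ n, 0 < e n := fun n => by positivity
  have hele : ∀ n, e n ≤ 1 := fun n => by
    rw [he]; simp only; rw [div_le_one (by positivity)]; linarith [n.cast_nonneg (α := ℝ)]
  have hlim : ∀ᵐ t ∂leb, Tendsto (fun n => Real.log (b t + e n)) atTop (𝓝 (Real.log (b t))) := by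
    filter_upwards [hpos] with t ht
    have h1 : Tendsto (fun n => b t + e n) atTop (𝓝 (b t + 0)) :=
      tendsto_const_nhds.add tendsto_one_div_add_atTop_nhds_zero_nat
    rw [add_zero] at h1
    exact h1.log ht.ne'
  have hint := fun n => integrable_log_add hb h0 (hepos n)
  refine ⟨(Real.measurable_log.comp_aemeasurable hb.aemeasurable).aestronglyMeasurable, ?_⟩
  have hfatou : ∫⁻ t, ‖Real.log (b t)‖ₑ ∂leb
      ≤ liminf (fun n => ∫⁻ t, ‖Real.log (b t + e n)‖ₑ ∂leb) atTop := by
    rw [lintegral_congr_ae (g := fun t => liminf (fun n => ‖Real.log (b t + e n)‖ₑ) atTop)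
      (by filter_upwards [hlim] with t ht using ht.enorm.liminf_eq.symm)]
    exact lintegral_liminf_le' fun n => (hint n).aemeasurable.enorm
  refine lt_of_le_of_lt hfatou ?_
  have hbd : ∀ n, ∫⁻ t, ‖Real.log (b t + e n)‖ₑ ∂leb
      ≤ ENNReal.ofReal (2 * (∫ t, b t ∂leb) + 2 - C) := fun n => by
    rw [← ofReal_integral_norm_eq_lintegral_enorm (hint n)]
    refine ENNReal.ofReal_le_ofReal ?_
    -- With x = log(b + e_n), use |x| = 2x⁺ - x and x⁺ ≤ b + 1, so that the lower bound on ∫x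
    -- controls ∫|x|.
    calc ∫ t, ‖Real.log (b t + e n)‖ ∂leb
        ≤ ∫ t, ((2 * b t + 2) - Real.log (b t + e n)) ∂leb := by
          refine integral_mono (hint n).norm
            (((hb.const_mul 2).add (integrable_const 2)).sub (hint n)) fun t => ?_
          have h1 := Real.log_le_sub_one_of_pos
            (show 0 < b t + e n by linarith [h0 t, hepos n])
          have h2 := hele n
          have h3 := h0 t
          simp only [Real.norm_eq_abs]
          rw [abs_le]
          constructor <;> linarith
      _ = 2 * (∫ t, b t ∂leb) + 2 - ∫ t, Real.log (b t + e n) ∂leb := by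
          have h2 : Integrable (fun t => 2 * b t + 2) leb :=
            (hb.const_mul 2).add (integrable_const 2)
          rw [integral_sub h2 (hint n),
            integral_add (hb.const_mul 2) (integrable_const 2), integral_const_mul]
          simp
      _ ≤ _ := by linarith [hC _ (hepos n)]
  exact lt_of_le_of_lt (liminf_le_of_le (by isBoundedDefault) fun B hB => by
    obtain ⟨n, hn⟩ := hB.exists
    exact hn.trans (hbd n)) ENNReal.ofReal_lt_top

/-! ### Square-root densities and weak convergence -/

/-- The square root of the density of the absolutely continuous part. -/
noncomputable def sqrtDensity (μ : Measure S1) (t : S1) : ℝ := √(density μ t).toReal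

instance haveLebesgueDecomposition_leb (ν : Measure S1) [IsFiniteMeasure ν] :
    ν.HaveLebesgueDecomposition leb :=
  Measure.haveLebesgueDecomposition_of_sigmaFinite ν leb

theorem sqrtDensity_nonneg (μ : Measure S1) (t : S1) : 0 ≤ sqrtDensity μ t := Real.sqrt_nonneg _

theorem sqrtDensity_sq (μ : Measure S1) (t : S1) :
    sqrtDensity μ t ^ 2 = (density μ t).toReal := Real.sq_sqrt ENNReal.toReal_nonneg

theorem measurable_sqrtDensity (μ : Measure S1) : Measurable (sqrtDensity μ) :=
  (Measure.measurable_rnDeriv _ _).ennreal_toReal.sqrt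

theorem integrable_sqrtDensity_sq (μ : Measure S1) [IsFiniteMeasure μ] :
    Integrable (fun t => sqrtDensity μ t ^ 2) leb := by
  simp only [sqrtDensity_sq]
  exact Measure.integrable_toReal_rnDeriv

theorem memLp_sqrtDensity (μ : Measure S1) [IsFiniteMeasure μ] :
    MemLp (sqrtDensity μ) 2 leb :=
  (memLp_two_iff_integrable_sq (measurable_sqrtDensity μ).aestronglyMeasurable).2
    (integrable_sqrtDensity_sq μ)

theorem integrable_sqrtDensity (μ : Measure S1) [IsFiniteMeasure μ] :
    Integrable (sqrtDensity μ) leb :=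
  (memLp_sqrtDensity μ).integrable (by norm_num)

theorem integrable_of_continuous {E : Type*} [NormedAddCommGroup E] {h : S1 → E}
    (hh : Continuous h)
    (ν : Measure S1) [IsFiniteMeasure ν] : Integrable h ν :=
  hh.integrable_of_hasCompactSupport (HasCompactSupport.of_compactSpace _)

theorem integral_eq_singularPart_add_density {ν : Measure S1} [IsFiniteMeasure ν] {h : S1 → ℝ}
    (hh : Integrable h ν) :
    ∫ t, h t ∂ν = ∫ t, h t ∂(ν.singularPart leb) + ∫ t, sqrtDensity ν t ^ 2 * h t ∂leb := by
  have h1 : ∫ t, h t ∂(leb.withDensity (ν.rnDeriv leb))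
      = ∫ t, sqrtDensity ν t ^ 2 * h t ∂leb := by
    rw [integral_withDensity_eq_integral_toReal_smul (Measure.measurable_rnDeriv _ _)
      (Measure.rnDeriv_lt_top _ _)]
    simp only [sqrtDensity_sq, smul_eq_mul, density]
  rw [← h1, ← integral_add_measure (hh.mono_measure (Measure.singularPart_le _ _))
    (hh.mono_measure (Measure.withDensity_rnDeriv_le _ _)),
    Measure.singularPart_add_rnDeriv ν leb]

theorem integral_sqrtDensity_sq_mul_le {ν : Measure S1} [IsFiniteMeasure ν] {h : S1 → ℝ}
    (hh : Integrable h ν) (h0 : ∀ t, 0 ≤ h t) :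
    ∫ t, sqrtDensity ν t ^ 2 * h t ∂leb ≤ ∫ t, h t ∂ν := by
  rw [integral_eq_singularPart_add_density hh]
  exact le_add_of_nonneg_left (integral_nonneg h0)

theorem tendsto_integral_of_continuous {ν : ℕ → FiniteMeasure S1} {μ : FiniteMeasure S1}
    (hν : Tendsto ν atTop (𝓝 μ)) {h : S1 → ℝ} (hh : Continuous h) :
    Tendsto (fun n => ∫ t, h t ∂(ν n : Measure S1)) atTop (𝓝 (∫ t, h t ∂(μ : Measure S1))) :=
  FiniteMeasure.tendsto_iff_forall_integral_tendsto.1 hν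
    (BoundedContinuousFunction.mkOfCompact ⟨h, hh⟩)

theorem integral_sqMeasure (Q : ℂ[X]) (h : S1 → ℝ) :
    ∫ t, h t ∂(sqMeasure Q : Measure S1) = ∫ t, ‖onCircle Q t‖ ^ 2 * h t ∂leb := by
  change ∫ t, h t ∂(leb.withDensity _) = _
  rw [integral_withDensity_eq_integral_toReal_smul
    ((continuous_onCircle Q).enorm.measurable.pow_const 2) (.of_forall fun t => by simp)]
  simp

/-! ### Upper semicontinuity of the affinity -/

/-- A continuous near-optimal weight in the arithmetic-geometric mean inequality. -/
theorem exists_continuous_weight (μ : Measure S1) [IsFiniteMeasure μ] {ε : ℝ} (hε : 0 < ε)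
    (hε1 : ε ≤ 1) : ∃ h : S1 → ℝ, Continuous h ∧ (∀ t, ε ≤ h t) ∧
      ((∫ t, h t ∂μ) + ∫ t, (h t)⁻¹ ∂leb) / 2
        ≤ (∫ t, sqrtDensity μ t ∂leb) + ε * (μ.real Set.univ + 2) := by
  obtain ⟨s, hs, hs1, hs2⟩ := Measure.mutuallySingular_singularPart μ leb
  set b := sqrtDensity μ with hb
  have hb0 := sqrtDensity_nonneg μ
  classical
  -- The ideal weight is 1/b, truncated here to stay in [ε, 1/ε]. The set s has full Lebesgue
  -- measure and is null for the singular part, so the value ε off s makes the singular mass cost at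
  -- most ε μ(S¹).
  set k : S1 → ℝ := fun t => if t ∈ s then max (b t + ε)⁻¹ ε else ε with hk
  have hkε : ∀ t, ε ≤ k t := fun t => by
    simp only [hk]; split_ifs <;> simp
  have hk1 : ∀ t, k t ≤ ε⁻¹ := fun t => by
    have h1 : ε ≤ ε⁻¹ := hε1.trans ((one_le_inv₀ hε).2 hε1)
    simp only [hk]; split_ifs
    · refine max_le ?_ h1
      exact inv_anti₀ hε (by linarith [hb0 t])
    · exact h1
  have hkm : Measurable k := Measurable.ite hs
    ((((measurable_sqrtDensity μ).add_const ε).inv).max measurable_const) measurable_const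
  have hki : ∀ (ν : Measure S1) [IsFiniteMeasure ν], Integrable k ν := fun ν _ =>
    Integrable.of_bound hkm.aestronglyMeasurable ε⁻¹ (.of_forall fun t => by
      rw [Real.norm_of_nonneg (hε.le.trans (hkε t))]; exact hk1 t)
  have hinv : ∀ {h : S1 → ℝ}, Measurable h → (∀ t, ε ≤ h t) → Integrable (fun t => (h t)⁻¹) leb :=
    fun {h} hm hle => Integrable.of_bound hm.inv.aestronglyMeasurable ε⁻¹ (.of_forall fun t => by
      rw [Real.norm_of_nonneg (inv_nonneg.2 (hε.le.trans (hle t)))]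
      exact inv_anti₀ hε (hle t))
  have hI1 : ∫ t, k t ∂μ ≤ (∫ t, b t ∂leb) + 2 * ε * μ.real Set.univ := by
    rw [integral_eq_singularPart_add_density (hki μ)]
    have h1 : ∫ t, k t ∂(μ.singularPart leb) ≤ ε * μ.real Set.univ := by
      have : ∫ t, k t ∂(μ.singularPart leb) = ∫ _, ε ∂(μ.singularPart leb) := by
        refine integral_congr_ae ?_
        filter_upwards [measure_eq_zero_iff_ae_notMem.1 hs1] with t ht
        simp [hk, ht]
      rw [this, integral_const, smul_eq_mul, mul_comm]
      exact mul_le_mul_of_nonneg_left (ENNReal.toReal_mono (measure_ne_top μ _)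
        (Measure.singularPart_le _ _ _)) hε.le
    have h2 : ∫ t, b t ^ 2 * k t ∂leb ≤ ∫ t, (b t + ε * b t ^ 2) ∂leb := by
      refine integral_mono_of_nonneg (.of_forall fun t => ?_)
        ((integrable_sqrtDensity μ).add ((integrable_sqrtDensity_sq μ).const_mul ε))
        (.of_forall fun t => ?_)
      · exact mul_nonneg (sq_nonneg _) (hε.le.trans (hkε t))
      · have h3 : k t ≤ (b t + ε)⁻¹ + ε := by
          have : 0 ≤ (b t + ε)⁻¹ := inv_nonneg.2 (by linarith [hb0 t])
          simp only [hk]; split_ifs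
          · exact max_le (by linarith) (by linarith)
          · linarith
        have h4 : b t ^ 2 * (b t + ε)⁻¹ ≤ b t := by
          have := hb0 t
          rw [← div_eq_mul_inv, div_le_iff₀ (by linarith [hb0 t])]
          nlinarith [mul_nonneg this hε.le]
        have := mul_le_mul_of_nonneg_left h3 (sq_nonneg (b t))
        change b t ^ 2 * k t ≤ b t + ε * b t ^ 2
        linarith
    have h3 : ∫ t, b t ^ 2 ∂leb ≤ μ.real Set.univ := by
      have := integral_sqrtDensity_sq_mul_le (ν := μ) (integrable_const (1 : ℝ))
        fun _ => zero_le_one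
      simpa using this
    rw [integral_add (integrable_sqrtDensity μ) ((integrable_sqrtDensity_sq μ).const_mul ε),
      integral_const_mul] at h2
    have := mul_le_mul_of_nonneg_left h3 hε.le
    linarith
  have hI2 : ∫ t, (k t)⁻¹ ∂leb ≤ (∫ t, b t ∂leb) + ε := by
    have : (∫ t, b t ∂leb) + ε = ∫ t, (b t + ε) ∂leb := by
      rw [integral_add (integrable_sqrtDensity μ) (integrable_const _)]; simp [hb]
    rw [this]
    refine integral_mono_ae (hinv hkm hkε) ((integrable_sqrtDensity μ).add (integrable_const _)) ?_
    filter_upwards [measure_eq_zero_iff_ae_notMem.1 hs2] with t ht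
    have hts : t ∈ s := by simpa using ht
    have hpos : 0 < b t + ε := by linarith [hb0 t]
    simp only [hk, hts, if_true]
    rw [inv_le_comm₀ (lt_max_of_lt_right hε) hpos]
    exact le_max_left _ _
  -- Approximation in both measures at once; inversion is ε⁻²-Lipschitz on [ε, ∞), so an error ε³
  -- becomes ε.
  obtain ⟨g, hg, -⟩ := (hki (μ + leb)).exists_boundedContinuous_integral_sub_le
    (show 0 < ε ^ 3 by positivity)
  have hgk : ∀ t, |max (g t) ε - k t| ≤ ‖k t - g t‖ := fun t => by
    rw [Real.norm_eq_abs, abs_sub_comm (k t)]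
    have := abs_max_sub_max_le_abs (g t) (k t) ε
    rwa [max_eq_left (hkε t)] at this
  have hgc : Continuous fun t => max (g t) ε := g.continuous.max continuous_const
  have hdi : ∀ (ν : Measure S1) [IsFiniteMeasure ν], Integrable (fun t => ‖k t - g t‖) ν :=
    fun ν _ => ((hki ν).sub (integrable_of_continuous g.continuous ν)).norm
  rw [integral_add_measure (hdi _) (hdi _)] at hg
  have hg1 : 0 ≤ ∫ t, ‖k t - g t‖ ∂μ := integral_nonneg fun _ => norm_nonneg _
  have hg2 : 0 ≤ ∫ t, ‖k t - g t‖ ∂leb := integral_nonneg fun _ => norm_nonneg _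
  refine ⟨fun t => max (g t) ε, hgc, fun t => le_max_right _ _, ?_⟩
  have hA : ∫ t, max (g t) ε ∂μ ≤ (∫ t, k t ∂μ) + ε ^ 3 := by
    calc ∫ t, max (g t) ε ∂μ ≤ ∫ t, (k t + ‖k t - g t‖) ∂μ := by
          refine integral_mono (integrable_of_continuous hgc μ) ((hki μ).add (hdi μ)) fun t => ?_
          have := (le_abs_self _).trans (hgk t)
          simp only at this ⊢
          linarith
      _ = (∫ t, k t ∂μ) + ∫ t, ‖k t - g t‖ ∂μ := integral_add (hki μ) (hdi μ)
      _ ≤ _ := by linarith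
  have hB : ∫ t, (max (g t) ε)⁻¹ ∂leb ≤ (∫ t, (k t)⁻¹ ∂leb) + ε := by
    calc ∫ t, (max (g t) ε)⁻¹ ∂leb ≤ ∫ t, ((k t)⁻¹ + ‖k t - g t‖ / ε ^ 2) ∂leb := by
          refine integral_mono (hinv hgc.measurable fun t => le_max_right _ _)
            ((hinv hkm hkε).add ((hdi leb).div_const _)) fun t => ?_
          have hk0 : 0 < k t := hε.trans_le (hkε t)
          have hm0 : 0 < max (g t) ε := lt_max_of_lt_right hε
          have h1 : (max (g t) ε)⁻¹ - (k t)⁻¹ = (k t - max (g t) ε) / (max (g t) ε * k t) := by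
            field_simp
          have h2 : (k t - max (g t) ε) / (max (g t) ε * k t) ≤ ‖k t - g t‖ / ε ^ 2 := by
            refine div_le_div₀ (norm_nonneg _) ?_ (by positivity) ?_
            · refine le_trans ?_ (hgk t)
              rw [abs_sub_comm]; exact le_abs_self _
            · rw [sq]; exact mul_le_mul (le_max_right _ _) (hkε t) hε.le hm0.le
          simp only
          linarith
      _ = (∫ t, (k t)⁻¹ ∂leb) + (∫ t, ‖k t - g t‖ ∂leb) / ε ^ 2 := by
          rw [integral_add (hinv hkm hkε) ((hdi leb).div_const _), integral_div]
      _ ≤ _ := by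
          have : (∫ t, ‖k t - g t‖ ∂leb) / ε ^ 2 ≤ ε := by
            rw [div_le_iff₀ (by positivity)]; nlinarith
          linarith
  have hε3 : ε ^ 3 ≤ ε := by
    calc ε ^ 3 ≤ ε ^ 1 := pow_le_pow_of_le_one hε.le hε1 (by norm_num)
      _ = ε := pow_one ε
  linarith

/-- Upper semicontinuity of the affinity with Lebesgue measure along `|Q_n|² dz → μ`. -/
theorem eventually_integral_norm_le {Q : ℕ → ℂ[X]} {μ : FiniteMeasure S1}
    (hQ : Tendsto (fun n => sqMeasure (Q n)) atTop (𝓝 μ)) {η : ℝ} (hη : 0 < η) :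
    ∀ᶠ n in atTop, ∫ t, ‖onCircle (Q n) t‖ ∂leb ≤ (∫ t, sqrtDensity μ t ∂leb) + η := by
  set M := (μ : Measure S1).real Set.univ with hM
  have hM0 : 0 ≤ M := measureReal_nonneg
  set ε := min 1 (η / (2 * (M + 2))) with hεdef
  have hε : 0 < ε := lt_min one_pos (by positivity)
  have hεη : ε * (M + 2) ≤ η / 2 := by
    calc ε * (M + 2) ≤ η / (2 * (M + 2)) * (M + 2) := by gcongr; exact min_le_right _ _
      _ = η / 2 := by field_simp
  obtain ⟨h, hc, hh, hle⟩ := exists_continuous_weight (μ : Measure S1) hε (min_le_left _ _)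
  have hinvc : Continuous fun t => (h t)⁻¹ := hc.inv₀ fun t => (hε.trans_le (hh t)).ne'
  have hlim : Tendsto (fun n => ((∫ t, h t ∂(sqMeasure (Q n) : Measure S1))
      + ∫ t, (h t)⁻¹ ∂leb) / 2) atTop (𝓝 (((∫ t, h t ∂(μ : Measure S1)) + ∫ t, (h t)⁻¹ ∂leb) / 2)) :=
    ((tendsto_integral_of_continuous hQ hc).add_const _).div_const 2
  filter_upwards [hlim.eventually_lt_const (show _ < (∫ t, sqrtDensity μ t ∂leb) + η by linarith)]
    with n hn
  refine le_trans ?_ hn.le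
  have hQc := (continuous_onCircle (Q n)).norm
  have h1 : Integrable (fun t => ‖onCircle (Q n) t‖ ^ 2 * h t) leb :=
    integrable_of_continuous ((hQc.pow 2).mul hc) leb
  have h2 : Integrable (fun t => (h t)⁻¹) leb := integrable_of_continuous hinvc leb
  rw [integral_sqMeasure, ← integral_add h1 h2, ← integral_div]
  refine integral_mono (integrable_of_continuous hQc leb) ((h1.add h2).div_const 2) fun t => ?_
  have hp : 0 < h t := hε.trans_le (hh t)
  -- AM-GM: 2|Q| ≤ |Q|² h + 1/h. The right side integrates to a quantity continuous under weak
  -- convergence.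
  have hs : 0 ≤ (‖onCircle (Q n) t‖ * h t - 1) ^ 2 / h t := by positivity
  have : (‖onCircle (Q n) t‖ * h t - 1) ^ 2 / h t
      = ‖onCircle (Q n) t‖ ^ 2 * h t + (h t)⁻¹ - 2 * ‖onCircle (Q n) t‖ := by
    field_simp; ring
  simp only
  linarith

theorem abs_le_half_div_add (x : ℝ) {ε : ℝ} (hε : 0 < ε) : |x| ≤ (x ^ 2 / ε + ε) / 2 := by
  have h1 : 0 ≤ (|x| - ε) ^ 2 / ε := by positivity
  have h2 : (|x| - ε) ^ 2 / ε = x ^ 2 / ε + ε - 2 * |x| := by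
    rw [← sq_abs x]; field_simp; ring
  linarith

/-- Weighted upper semicontinuity of the affinity with Lebesgue measure along `ν_n → dz`. -/
theorem eventually_integral_mul_sqrtDensity_le {ν : ℕ → FiniteMeasure S1}
    (hν : Tendsto ν atTop (𝓝 lebFinite)) {w : S1 → ℝ} (hw : MemLp w 2 leb)
    (hw0 : ∀ t, 0 ≤ w t) {η : ℝ} (hη : 0 < η) :
    ∀ᶠ n in atTop, ∫ t, w t * sqrtDensity (ν n) t ∂leb ≤ (∫ t, w t ∂leb) + η := by
  set ε := η / 4 with hεdef
  have hε : 0 < ε := by positivity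
  have hw' : MemLp w (ENNReal.ofReal 2) leb := by simpa using hw
  -- The weight w is only in L², so a continuous g replaces it: |g| is paired with c by 2c ≤ 1 + c²,
  -- and w - g by AM-GM with parameter ε.
  obtain ⟨g, hg, -⟩ := hw'.exists_boundedContinuous_integral_rpow_sub_le zero_lt_two
    (show 0 < ε ^ 2 by positivity)
  simp only [Real.rpow_two, Real.norm_eq_abs, sq_abs] at hg
  have hwi : Integrable w leb := hw.integrable (by norm_num)
  have hdi : Integrable (fun t => (w t - g t) ^ 2) leb := by
    have : MemLp (fun t => w t - g t) 2 leb := hw.sub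
      (MemLp.of_bound g.continuous.aestronglyMeasurable ‖g‖ (.of_forall g.norm_coe_le_norm))
    exact this.integrable_sq
  have hdε : (∫ t, (w t - g t) ^ 2 ∂leb) / ε ≤ ε := by
    rw [div_le_iff₀ hε, ← sq]; exact hg
  have hcg : Continuous fun t => |g t| := g.continuous.abs
  have hgw : ∫ t, |g t| ∂leb ≤ (∫ t, w t ∂leb) + ε := by
    have hbi : Integrable (fun t => ((w t - g t) ^ 2 / ε + ε) / 2) leb :=
      ((hdi.div_const ε).add (integrable_const ε)).div_const 2
    calc ∫ t, |g t| ∂leb ≤ ∫ t, (w t + ((w t - g t) ^ 2 / ε + ε) / 2) ∂leb := by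
          refine integral_mono (integrable_of_continuous hcg leb) (hwi.add hbi) fun t => ?_
          have h1 := abs_le_half_div_add (w t - g t) hε
          have h2 : |g t| ≤ |w t| + |w t - g t| := by
            have := abs_sub (w t) (w t - g t)
            rwa [sub_sub_cancel] at this
          rw [abs_of_nonneg (hw0 t)] at h2
          simp only
          linarith
      _ = (∫ t, w t ∂leb) + ((∫ t, (w t - g t) ^ 2 ∂leb) / ε + ε) / 2 := by
          rw [integral_add hwi hbi, integral_div, integral_add (hdi.div_const ε)
            (integrable_const ε), integral_div]
          simp
      _ ≤ _ := by linarith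
  have hc : Continuous fun t => |g t| + ε := hcg.add continuous_const
  have hlim : Tendsto (fun n => ((∫ t, |g t| ∂leb) + ε
      + ∫ t, (|g t| + ε) ∂(ν n : Measure S1)) / 2) atTop
      (𝓝 (((∫ t, |g t| ∂leb) + ε + ∫ t, (|g t| + ε) ∂leb) / 2)) :=
    ((tendsto_integral_of_continuous hν hc).const_add _).div_const 2
  have hlt : ((∫ t, |g t| ∂leb) + ε + ∫ t, (|g t| + ε) ∂leb) / 2 < (∫ t, w t ∂leb) + η := by
    rw [integral_add (integrable_of_continuous hcg leb) (integrable_const ε)]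
    simp only [integral_const, probReal_univ, one_smul]
    linarith
  filter_upwards [hlim.eventually_lt_const hlt] with n hn
  refine le_trans ?_ hn.le
  have h1 := integral_sqrtDensity_sq_mul_le (ν := (ν n : Measure S1))
    (integrable_of_continuous hc _) fun t => by positivity
  have hi1 : Integrable (fun t => sqrtDensity (ν n) t ^ 2 * (|g t| + ε)) leb := by
    obtain ⟨K, hK⟩ := isCompact_univ.exists_bound_of_continuousOn hc.continuousOn
    exact (integrable_sqrtDensity_sq _).mul_bdd hc.aestronglyMeasurable
      (c := K) (.of_forall fun t => hK t (Set.mem_univ t))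
  have hi2 : Integrable (fun t => |g t| + (w t - g t) ^ 2 / ε) leb :=
    (integrable_of_continuous hcg leb).add (hdi.div_const ε)
  have hi3 : Integrable (fun t => w t * sqrtDensity (ν n) t) leb :=
    hw.integrable_mul (memLp_sqrtDensity _)
  calc ∫ t, w t * sqrtDensity (ν n) t ∂leb
      ≤ ∫ t, (|g t| + (w t - g t) ^ 2 / ε + sqrtDensity (ν n) t ^ 2 * (|g t| + ε)) / 2 ∂leb := by
        refine integral_mono hi3 ((hi2.add hi1).div_const 2) fun t => ?_
        set c := sqrtDensity (ν n) t with hcdef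
        have hc0 : 0 ≤ c := sqrtDensity_nonneg _ _
        have e1 : g t * c ≤ |g t| * (1 + c ^ 2) / 2 := by
          have h3 : g t * c ≤ |g t| * c := mul_le_mul_of_nonneg_right (le_abs_self _) hc0
          nlinarith [mul_nonneg (abs_nonneg (g t)) (sq_nonneg (c - 1))]
        have e2 : (w t - g t) * c ≤ ((w t - g t) ^ 2 / ε + ε * c ^ 2) / 2 := by
          have h3 : 0 ≤ (w t - g t - ε * c) ^ 2 / ε := by positivity
          have h4 : (w t - g t - ε * c) ^ 2 / ε
              = (w t - g t) ^ 2 / ε + ε * c ^ 2 - 2 * ((w t - g t) * c) := by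
            field_simp; ring
          linarith
        simp only
        linarith
    _ = ((∫ t, |g t| ∂leb) + (∫ t, (w t - g t) ^ 2 ∂leb) / ε
          + ∫ t, sqrtDensity (ν n) t ^ 2 * (|g t| + ε) ∂leb) / 2 := by
        rw [integral_div, integral_add hi2 hi1,
          integral_add (integrable_of_continuous hcg leb) (hdi.div_const ε), integral_div]
    _ ≤ _ := by linarith

/-! ### Tail factorization and L¹ convergence of the moduli -/

theorem onCircle_mul (Q R : ℂ[X]) (t : S1) : onCircle (Q * R) t = onCircle Q t * onCircle R t :=
  eval_mul

theorem partialProd_add (P : ℕ → ℂ[X]) (n m : ℕ) :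
    partialProd P (n + m) = partialProd P n * partialProd (fun i => P (n + i)) m :=
  Finset.prod_range_add _ _ _

/-- |S_n|² is continuous, so multiplying by it commutes with the weak limit defining the tail. -/
theorem eq_withDensity_tail {P : ℕ → ℂ[X]} {μ ν : FiniteMeasure S1} {n : ℕ}
    (hμ : Tendsto (fun n => sqMeasure (partialProd P n)) atTop (𝓝 μ))
    (hν : Tendsto (fun m => sqMeasure (partialProd (fun i => P (n + i)) m)) atTop (𝓝 ν)) :
    (μ : Measure S1)
      = (ν : Measure S1).withDensity fun t => ‖onCircle (partialProd P n) t‖ₑ ^ 2 := by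
  set S := partialProd P n with hS
  have hSc := continuous_onCircle S
  have hmeas : Measurable fun t => ‖onCircle S t‖ₑ ^ 2 := hSc.enorm.measurable.pow_const 2
  have hfin : IsFiniteMeasure ((ν : Measure S1).withDensity fun t => ‖onCircle S t‖ₑ ^ 2) := by
    refine isFiniteMeasure_withDensity ?_
    have := (integrable_of_continuous (hSc.norm.pow 2) (ν : Measure S1)).2.ne
    simpa [enorm_pow] using this
  refine ext_of_forall_integral_eq_of_IsFiniteMeasure fun g => ?_
  rw [integral_withDensity_eq_integral_toReal_smul hmeas (.of_forall fun t => by simp)]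
  have h1 : Tendsto (fun m => ∫ t, g t ∂(sqMeasure (partialProd P (n + m)) : Measure S1)) atTop
      (𝓝 (∫ t, g t ∂(μ : Measure S1))) :=
    (tendsto_integral_of_continuous hμ g.continuous).comp
      (tendsto_add_atTop_nat n |>.congr fun m => add_comm m n)
  have h2 := tendsto_integral_of_continuous hν ((hSc.norm.pow 2).mul g.continuous)
  refine tendsto_nhds_unique h1 ?_
  simp only [smul_eq_mul, ENNReal.toReal_pow, toReal_enorm]
  refine h2.congr fun m => ?_
  rw [integral_sqMeasure, integral_sqMeasure]
  refine integral_congr_ae (.of_forall fun t => ?_)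
  simp only [partialProd_add, onCircle_mul, norm_mul, Pi.mul_apply, Pi.pow_apply, ← hS]
  ring

theorem sqrtDensity_eq_mul_tail {P : ℕ → ℂ[X]} {μ ν : FiniteMeasure S1} {n : ℕ}
    (hμ : Tendsto (fun n => sqMeasure (partialProd P n)) atTop (𝓝 μ))
    (hν : Tendsto (fun m => sqMeasure (partialProd (fun i => P (n + i)) m)) atTop (𝓝 ν)) :
    ∀ᵐ t ∂leb, sqrtDensity μ t = ‖onCircle (partialProd P n) t‖ * sqrtDensity ν t := by
  have h := Measure.rnDeriv_withDensity_left (μ := (ν : Measure S1)) (ν := leb)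
    (f := fun t => ‖onCircle (partialProd P n) t‖ₑ ^ 2)
    ((continuous_onCircle _).enorm.measurable.pow_const 2).aemeasurable
    (.of_forall fun t => by simp)
  rw [← eq_withDensity_tail hμ hν] at h
  filter_upwards [h] with t ht
  rw [sqrtDensity, sqrtDensity, density, ht, density, ENNReal.toReal_mul,
    Real.sqrt_mul ENNReal.toReal_nonneg]
  simp [Real.sqrt_sq]

/-- For a product of class (L), the moduli of the partial products converge in `L¹` to the square
root of the density of the absolutely continuous part. -/
theorem tendsto_integral_abs_norm_sub_sqrtDensity {P : ℕ → ℂ[X]} {μ : FiniteMeasure S1}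
    {ν : ℕ → FiniteMeasure S1}
    (hμ : Tendsto (fun n => sqMeasure (partialProd P n)) atTop (𝓝 μ))
    (hν : ∀ n, Tendsto (fun m => sqMeasure (partialProd (fun i => P (n + i)) m)) atTop (𝓝 (ν n)))
    (hL : Tendsto ν atTop (𝓝 lebFinite)) :
    Tendsto (fun n => ∫ t, |‖onCircle (partialProd P n) t‖ - sqrtDensity μ t| ∂leb)
      atTop (𝓝 0) := by
  set b := sqrtDensity (μ : Measure S1) with hb
  set B := ∫ t, b t ∂leb with hB
  have hB0 : 0 ≤ B := integral_nonneg (sqrtDensity_nonneg _)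
  rw [Metric.tendsto_nhds]
  intro η hη
  -- The two semicontinuity errors κ sum to at most δ², and the weighted AM-GM below then gives at
  -- most (δ + δ(B + 1))/2 = η/2.
  set δ := η / (B + 2) with hδdef
  have hδ : 0 < δ := by positivity
  set κ := min 1 (δ ^ 2 / 2) with hκdef
  have hκ : 0 < κ := lt_min one_pos (by positivity)
  filter_upwards [eventually_integral_norm_le hμ hκ,
    eventually_integral_mul_sqrtDensity_le hL (memLp_sqrtDensity (μ : Measure S1))
      (sqrtDensity_nonneg _) hκ] with n h1 h2
  set a : S1 → ℝ := fun t => ‖onCircle (partialProd P n) t‖ with ha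
  set c := sqrtDensity (ν n : Measure S1) with hc
  have hbi : Integrable b leb := integrable_sqrtDensity _
  have hai : Integrable a leb := integrable_of_continuous (continuous_onCircle _).norm leb
  have hbc : Integrable (fun t => b t * c t) leb :=
    (memLp_sqrtDensity (μ : Measure S1)).integrable_mul (memLp_sqrtDensity (ν n : Measure S1))
  have hq : Integrable (fun t => b t * c t + a t - 2 * b t) leb :=
    (hbc.add hai).sub (hbi.const_mul 2)
  have hqI : ∫ t, (b t * c t + a t - 2 * b t) ∂leb ≤ δ ^ 2 := by
    have hbca : Integrable (fun t => b t * c t + a t) leb := hbc.add hai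
    rw [integral_sub hbca (hbi.const_mul 2), integral_add hbc hai,
      integral_const_mul]
    have : κ ≤ δ ^ 2 / 2 := min_le_right _ _
    linarith
  have haI : ∫ t, a t ∂leb ≤ B + 1 := h1.trans (by gcongr; exact min_le_left _ _)
  have hle : ∫ t, |a t - b t| ∂leb
      ≤ ∫ t, ((b t * c t + a t - 2 * b t) / δ + δ * a t) / 2 ∂leb := by
    refine integral_mono_ae (hai.sub hbi).abs
      (((hq.div_const δ).add (hai.const_mul δ)).div_const 2) ?_
    filter_upwards [sqrtDensity_eq_mul_tail hμ (hν n)] with t ht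
    change b t = a t * c t at ht
    have ha0 : 0 ≤ a t := norm_nonneg _
    have e1 := mul_le_mul_of_nonneg_left (abs_le_half_div_add (1 - c t) hδ) ha0
    have e2 : |a t - b t| = a t * |1 - c t| := by
      rw [ht, ← mul_one_sub, abs_mul, abs_of_nonneg ha0]
    have e3 : ((b t * c t + a t - 2 * b t) / δ + δ * a t) / 2
        = a t * (((1 - c t) ^ 2 / δ + δ) / 2) := by
      rw [ht]; field_simp; ring
    change |a t - b t| ≤ ((b t * c t + a t - 2 * b t) / δ + δ * a t) / 2
    rw [e2, e3]
    exact e1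
  rw [integral_div, integral_add (hq.div_const δ) (hai.const_mul δ), integral_div,
    integral_const_mul] at hle
  have hqδ : (∫ t, (b t * c t + a t - 2 * b t) ∂leb) / δ ≤ δ := by
    rw [div_le_iff₀ hδ, ← sq]; exact hqI
  have haδ : δ * ∫ t, a t ∂leb ≤ δ * (B + 1) := by gcongr
  rw [Real.dist_eq, sub_zero, abs_of_nonneg (integral_nonneg fun _ => abs_nonneg _)]
  have hδη : δ * (B + 2) = η := by rw [hδdef]; field_simp
  nlinarith

/-! ### Phases and vanishing negative frequencies -/

theorem phase_mul_norm (P : ℕ → ℂ[X]) (n : ℕ) (t : S1) :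
    phase P n t * ‖onCircle (partialProd P n) t‖ = onCircle (partialProd P n) t := by
  rw [phase]
  by_cases h : onCircle (partialProd P n) t = 0
  · simp [h]
  · exact div_mul_cancel₀ _ (by simpa using h)

theorem norm_phase_le_one (P : ℕ → ℂ[X]) (n : ℕ) (t : S1) : ‖phase P n t‖ ≤ 1 := by
  rw [phase, norm_div, Complex.norm_real, norm_norm]
  exact div_self_le_one _

theorem measurable_phase (P : ℕ → ℂ[X]) (n : ℕ) : Measurable (phase P n) :=
  (continuous_onCircle _).measurable.div
    (Complex.measurable_ofReal.comp (continuous_onCircle _).norm.measurable)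

theorem integral_fourier_mul_onCircle (Q : ℂ[X]) {k : ℕ} (hk : k ≠ 0) :
    ∫ t, fourier (k : ℤ) t * onCircle Q t ∂leb = 0 := by
  have hmono : ∀ t : S1, fourier (k : ℤ) t * onCircle Q t
      = ∑ j ∈ Finset.range (Q.natDegree + 1), Q.coeff j * fourier ((k + j : ℕ) : ℤ) t := fun t => by
    rw [onCircle, eval_eq_sum_range, Finset.mul_sum]
    refine Finset.sum_congr rfl fun j _ => ?_
    rw [fourier_natCast_apply, fourier_natCast_apply, pow_add]
    ring
  simp only [hmono]
  rw [integral_finsetSum _ fun j _ =>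
    (integrable_of_continuous (map_continuous (fourier _)) leb).const_mul _]
  refine Finset.sum_eq_zero fun j _ => ?_
  have h := congrFun (fourierCoeff_fourier (T := 1) ((k + j : ℕ) : ℤ)) 0
  rw [fourierCoeff, Pi.single_eq_of_ne (by omega)] at h
  simp only [neg_zero, fourier_zero, one_smul] at h
  rw [integral_const_mul]
  exact mul_eq_zero_of_right _ h

/-- Strong `L¹` convergence times weak* convergence. -/
theorem fourierCoeff_neg_eq_zero_of_isWeakStarLimit {P : ℕ → ℂ[X]} {b : S1 → ℝ} {φ : S1 → ℂ}
    (hb : Integrable b leb)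
    (hlim : Tendsto (fun n => ∫ t, |‖onCircle (partialProd P n) t‖ - b t| ∂leb) atTop (𝓝 0))
    (hφ : IsWeakStarLimit (phase P) φ) {n : ℤ} (hn : n < 0) :
    fourierCoeff (fun t => (b t : ℂ) * φ t) n = 0 := by
  obtain ⟨-, i, hi, hw⟩ := hφ
  obtain ⟨k, hk⟩ : ∃ k : ℕ, -n = k := ⟨(-n).toNat, by omega⟩
  have hk0 : k ≠ 0 := by omega
  have hgi : Integrable (fun t => fourier (k : ℤ) t * (b t : ℂ)) leb := by
    refine hb.ofReal.bdd_mul (c := 1)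
      (map_continuous (fourier (k : ℤ))).aestronglyMeasurable (.of_forall fun t => ?_)
    rw [fourier_apply, Circle.norm_coe]
  have h1 := hw _ hgi
  have hbound : ∀ n, ‖∫ t, fourier (k : ℤ) t * (b t : ℂ) * phase P n t ∂leb‖
      ≤ ∫ t, |‖onCircle (partialProd P n) t‖ - b t| ∂leb := fun n => by
    have hi1 : Integrable (fun t => fourier (k : ℤ) t * (b t : ℂ) * phase P n t) leb :=
      hgi.mul_bdd (c := 1) (measurable_phase P n).aestronglyMeasurable
        (.of_forall (norm_phase_le_one P n))
    have hi2 : Integrable (fun t => fourier (k : ℤ) t * onCircle (partialProd P n) t) leb :=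
      integrable_of_continuous ((map_continuous _).mul (continuous_onCircle _)) leb
    -- Subtracting ∫ z^k S_n = 0 turns the integrand into z^k φ_n (b - |S_n|), which is small in L¹.
    have h2 : ∫ t, fourier (k : ℤ) t * (b t : ℂ) * phase P n t ∂leb
        = ∫ t, (fourier (k : ℤ) t * (b t : ℂ) * phase P n t
          - fourier (k : ℤ) t * onCircle (partialProd P n) t) ∂leb := by
      rw [integral_sub hi1 hi2, integral_fourier_mul_onCircle _ hk0, sub_zero]
    rw [h2]
    refine norm_integral_le_of_norm_le ((integrable_of_continuous
      (continuous_onCircle _).norm leb).sub hb).abs (.of_forall fun t => ?_)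
    have h3 : fourier (k : ℤ) t * (b t : ℂ) * phase P n t
        - fourier (k : ℤ) t * onCircle (partialProd P n) t
        = fourier (k : ℤ) t * phase P n t
          * ((b t - ‖onCircle (partialProd P n) t‖ : ℝ) : ℂ) := by
      conv_lhs => rw [← phase_mul_norm P n t]
      push_cast
      ring
    rw [h3, norm_mul, norm_mul, fourier_apply, Circle.norm_coe, one_mul, Complex.norm_real,
      Real.norm_eq_abs, abs_sub_comm]
    exact mul_le_of_le_one_left (abs_nonneg _) (norm_phase_le_one P n t)
  have h2 := (squeeze_zero_norm hbound hlim).comp hi.tendsto_atTop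
  have h3 := tendsto_nhds_unique h1 h2
  rw [fourierCoeff, hk]
  simp only [smul_eq_mul, ← mul_assoc]
  exact h3

/-! ### Mahler measure and conclusion -/

/-- Both parts of the log-integral are finite, so their difference in `EReal` is a real number and
its exponential is positive. -/
theorem mahlerMeasure_acPart_pos {μ : Measure S1} [IsFiniteMeasure μ]
    (hpos : ∀ᵐ t ∂leb, 0 < density μ t)
    (hlog : Integrable (fun t => Real.log (density μ t).toReal) leb) :
    0 < mahlerMeasure (acPart μ) := by
  have hlogeq : ∀ᵐ t ∂leb, ENNReal.log (density (acPart μ) t)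
      = (Real.log (density μ t).toReal : EReal) := by
    filter_upwards [hpos, Measure.rnDeriv_withDensity leb (Measure.measurable_rnDeriv μ leb),
      Measure.rnDeriv_lt_top μ leb] with t h1 h2 h3
    rw [density, acPart]
    change ENNReal.log ((leb.withDensity (μ.rnDeriv leb)).rnDeriv leb t) = _
    rw [h2]
    exact ENNReal.log_pos_real h1.ne' h3.ne
  have hfin : ∀ f : S1 → ℝ, Integrable f leb → ∫⁻ t, ENNReal.ofReal (f t) ∂leb ≠ ∞ := fun f hf =>
    ((lintegral_mono fun t => Real.ofReal_le_enorm (f t)).trans_lt hf.2).ne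
  have hA : ∫⁻ t, (ENNReal.log (density (acPart μ) t)).toENNReal ∂leb ≠ ∞ := by
    rw [lintegral_congr_ae (g := fun t => ENNReal.ofReal (Real.log (density μ t).toReal))
      (by filter_upwards [hlogeq] with t ht; rw [ht, EReal.real_coe_toENNReal])]
    exact hfin _ hlog
  have hB : ∫⁻ t, (-ENNReal.log (density (acPart μ) t)).toENNReal ∂leb ≠ ∞ := by
    rw [lintegral_congr_ae (g := fun t => ENNReal.ofReal (-Real.log (density μ t).toReal))
      (by filter_upwards [hlogeq] with t ht
          rw [ht, ← EReal.coe_neg, EReal.real_coe_toENNReal])]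
    exact hfin _ hlog.neg
  rw [mahlerMeasure, ← EReal.exp_bot, EReal.exp_lt_exp_iff, logIntegral]
  lift (∫⁻ t, (ENNReal.log (density (acPart μ) t)).toENNReal ∂leb) to NNReal using hA with A
  lift (∫⁻ t, (-ENNReal.log (density (acPart μ) t)).toENNReal ∂leb) to NNReal using hB with B
  exact EReal.bot_lt_coe ((A : ℝ) - B)

end RieszProduct

open RieszProduct in
theorem mainTheorem2 (P : ℕ → ℂ[X]) (μ : FiniteMeasure S1)
    (hμ : IsGeneralizedRieszProduct P μ) (hL : IsClassL P) (houter : ∀ j, IsOuter (P j))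
    (φ : S1 → ℂ) (hφ : IsWeakStarLimit (phase P) φ)
    (hne : ∀ᵐ t ∂leb, 0 < density (μ : Measure S1) t → φ t ≠ 0) :
    (μ : Measure S1) ⟂ₘ leb ∨
      (0 < mahlerMeasure (acPart (μ : Measure S1)) ∧
        (∀ᵐ t ∂leb, 0 < density (μ : Measure S1) t) ∧
        Integrable (fun t => Real.log (density (μ : Measure S1) t).toReal) leb) := by
  by_cases hsing : (μ : Measure S1) ⟂ₘ leb
  · exact .inl hsing
  refine .inr ?_
  obtain ⟨ν, hν, hνL⟩ := hL id strictMono_id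
  set b := sqrtDensity (μ : Measure S1) with hb
  have hb0 : ∀ t, 0 ≤ b t := sqrtDensity_nonneg _
  have hbi : Integrable b leb := integrable_sqrtDensity _
  have hlim := tendsto_integral_abs_norm_sub_sqrtDensity hμ.tendsto
    (fun n => (hν n).tendsto) hνL
  have hcoef := fun n : ℤ => fourierCoeff_neg_eq_zero_of_isWeakStarLimit hbi hlim hφ (n := n)
  have hF : MemLp (fun t => (b t : ℂ) * φ t) 2 leb :=
    hφ.1.mul' (p := 2) (q := ∞) (r := 2) (memLp_sqrtDensity (μ : Measure S1)).ofReal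
  have hFne : ¬ (fun t => (b t : ℂ) * φ t) =ᵐ[leb] 0 := fun h => by
    refine hsing ((Measure.rnDeriv_eq_zero _ _).1 ?_)
    filter_upwards [h, hne, Measure.rnDeriv_lt_top (μ : Measure S1) leb] with t h1 h2 h3
    by_contra h4
    have hpos : 0 < density (μ : Measure S1) t := pos_iff_ne_zero.2 h4
    rcases mul_eq_zero.1 h1 with h5 | h5
    · have h6 : b t ≠ 0 := (Real.sqrt_pos.2 (ENNReal.toReal_pos h4 h3.ne)).ne'
      exact h6 (by exact_mod_cast h5)
    · exact h2 hpos h5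
  obtain ⟨C, hC⟩ := exists_le_integral_log_of_fourierCoeff_neg_eq_zero hF hcoef hFne
  -- The added 1 keeps K positive, as log K is needed.
  set K := (eLpNorm φ ∞ leb).toReal + 1 with hK
  have hK0 : 0 < K := by positivity
  have hφK : ∀ᵐ t ∂leb, ‖φ t‖ ≤ K := by
    filter_upwards [ae_le_eLpNormEssSup (f := φ) (μ := leb)] with t ht
    rw [← eLpNorm_exponent_top] at ht
    have := ENNReal.toReal_mono hφ.1.eLpNorm_ne_top ht
    rw [toReal_enorm] at this
    linarith
  have hCb : ∀ ε : ℝ, 0 < ε → C - Real.log K ≤ ∫ t, Real.log (b t + ε) ∂leb := fun ε hε => by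
    -- Scaling the regularization by K lets K factor out: b|φ| + Kε ≤ K(b + ε).
    have h1 := hC (K * ε) (by positivity)
    have hFi := (hF.integrable (by norm_num)).norm
    have hli := integrable_log_add hbi hb0 hε
    have h2 : ∫ t, Real.log (‖(b t : ℂ) * φ t‖ + K * ε) ∂leb
        ≤ ∫ t, (Real.log K + Real.log (b t + ε)) ∂leb := by
      refine integral_mono_ae (integrable_log_add hFi (fun _ => norm_nonneg _) (by positivity))
        ((integrable_const _).add hli) ?_
      filter_upwards [hφK] with t ht
      have hbt := hb0 t
      change Real.log (‖(b t : ℂ) * φ t‖ + K * ε) ≤ Real.log K + Real.log (b t + ε)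
      rw [← Real.log_mul hK0.ne' (by linarith)]
      refine Real.log_le_log (by positivity) ?_
      rw [norm_mul, Complex.norm_real, Real.norm_of_nonneg hbt]
      nlinarith [mul_le_mul_of_nonneg_left ht hbt]
    rw [integral_add (integrable_const _) hli] at h2
    simp only [integral_const, probReal_univ, one_smul] at h2
    linarith
  obtain ⟨hbpos, hblog⟩ := pos_and_integrable_log_of_le_integral hbi hb0 hCb
  have hpos : ∀ᵐ t ∂leb, 0 < density (μ : Measure S1) t := by
    filter_upwards [hbpos] with t ht
    exact (ENNReal.toReal_pos_iff.1 (Real.sqrt_pos.1 ht)).1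
  have hlog : Integrable (fun t => Real.log (density (μ : Measure S1) t).toReal) leb := by
    refine (hblog.const_mul 2).congr (.of_forall fun t => ?_)
    simp only [hb, sqrtDensity]
    rw [Real.log_sqrt ENNReal.toReal_nonneg]
    ring
  exact ⟨mahlerMeasure_acPart_pos hpos hlog, hpos, hlog⟩
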